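/- Let $(K,\nu)$ be a rank one discrete valued field, normalized so that $\nu(K^*)=\mathbb Z$, with valuation ring $R_\nu$ and residue field $\mathbb F_\nu$; extend $\nu$ to polynomials by $\nu\big(\sum_j c_jx^j\big)=\min_j\nu(c_j)$. Let $f\in R_\nu[x]$ be a monic polynomial and let $\phi\in R_\nu[x]$ be a monic polynomial whose reduction $\overline{\phi}$ is irreducible in $\mathbb F_\nu[x]$, and assume that $\overline{f}$ is a power of $\overline{\phi}$ in $\mathbb F_\nu[x]$. Let $$f(x)=\phi(x)^n+a_{n-1}(x)\phi(x)^{n-1}+\cdots+a_0(x),\qquad a_i\in R_\nu[x],\ \deg a_i<\deg\phi,$$ be the $\phi$-expansion of $f$, with $a_0\neq 0$. Put $\lambda=\nu(a_0)/n$ and assume that $\nu(a_i)\ge \nu(a_0)-i\lambda$ for every $i=0,\dots,n-1$. Assume moreover that $f$ is irreducible over $K$, and let $L=K(\alpha)$ be the simple extension of $K$ generated by a root $\alpha$ of $f$. Then there are at most $\gcd(\nu(a_0),n)$ distinct (that is, pairwise inequivalent) valuations of $L$ extending $\nu$. -/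

import Mathlib

open Polynomial
open scoped WithZero

/-- The Gauss extension to `K[X]` of the valuation with valuation ring `v.valuationSubring`, on
polynomials with coefficients in that ring, written multiplicatively: the maximum of the values
of the coefficients (that is, their minimum in additive notation), and `0` for `p = 0`. -/
noncomputable def gaussValue {K : Type*} [Field K] (v : Valuation K ℤᵐ⁰)
    (p : v.valuationSubring[X]) : ℤᵐ⁰ :=
  p.support.sup fun j => v (p.coeff j : K)

/-- The additive integer value `ν(p) = min_j ν(c_j)` of a nonzero polynomial `p = ∑ c_j x^j`, where
`ν(c) = m` means `v c = exp (-m)`. It is only meaningful for `p ≠ 0`, where `ν(p)` is finite. -/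
noncomputable def gaussOrd {K : Type*} [Field K] (v : Valuation K ℤᵐ⁰)
    (p : v.valuationSubring[X]) : ℤ :=
  -WithZero.log (gaussValue v p)

/-- `f = φ^n + a_{n-1} φ^{n-1} + ⋯ + a_0` is the `φ`-expansion of `f`, with top term `φ^n`:
every coefficient `a_i` is a polynomial of degree less than that of `φ`. -/
def IsMonicExpansion {R : Type*} [CommRing R] (f φ : R[X]) (n : ℕ) (a : ℕ → R[X]) : Prop :=
  f = φ ^ n + ∑ i ∈ Finset.range n, a i * φ ^ i ∧ ∀ i < n, (a i).degree < φ.degree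

/-! Write `y = φ(α)`, `m = deg φ`, `d = gcd(ν(a₀), n)`, `e = n / d`. Every extension `w` of `ν`
takes the same values on the elements `p(α) y^j` with `deg p < m`. Indeed `p(α)` has the Gauss value
of `p` (`valuation_aeval_eq`), since `φ` is irreducible modulo the maximal ideal and `w y < 1`. The
single slope of the `φ`-expansion forces `w y ^ n = w c₀`, where `c₀` is a coefficient of `a₀` of
extremal value (`valuation_aeval_key_pow`). For `j < e` these values lie in distinct cosets of the
value group of `K`, because `e` is the denominator of `λ`. Given a finite set of `r` inequivalent
extensions `w i`, weak approximation yields `b i` of value `1` at `w i` and less than `1` at the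
others. The `r * e * m` elements `b i * α^k * y^j` with `k < m`, `j < e` are then linearly
independent over `K` (`eq_zero_of_sum_separated`). Since `[L : K] ≤ n * m`, it follows that `r * e ≤
n`, that is, `r ≤ d`. -/

section General

/-! ### Archimedean valuations and weak approximation. -/

variable {K L Γ Γ₀ : Type*} [Field K] [Field L] [Algebra K L]
  [LinearOrderedCommGroupWithZero Γ] [LinearOrderedCommGroupWithZero Γ₀]

/-- Over an algebraic extension, some positive power of every nonzero value is a value of the
base field. -/
theorem Valuation.exists_pow_eq_algebraMap [Algebra.IsAlgebraic K L] (w : Valuation L Γ) {x : L}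
    (hx : x ≠ 0) : ∃ N : ℕ, 0 < N ∧ ∃ c : K, w x ^ N = w (algebraMap K L c) := by
  obtain ⟨p, hp0, hp⟩ := Algebra.IsAlgebraic.isAlgebraic (R := K) x
  rw [aeval_eq_sum_range, Finset.sum_range] at hp
  classical
  have hwx : w x ≠ 0 := by simpa using hx
  obtain ⟨i, -, hi⟩ := Finset.exists_max_image Finset.univ
    (fun i : Fin (p.natDegree + 1) => w (p.coeff i • x ^ (i : ℕ))) ⟨0, Finset.mem_univ _⟩
  have hi0 : w (p.coeff i • x ^ (i : ℕ)) ≠ 0 := by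
    intro h
    have := hi (Fin.last _) (Finset.mem_univ _)
    rw [h] at this
    simp [Algebra.smul_def, hx, hp0] at this
  -- A vanishing sum cannot have a unique dominant term; two tied terms express a power of `w x` as
  -- a quotient of coefficient values.
  obtain ⟨j, hji, hj⟩ : ∃ j ≠ i, w (p.coeff j • x ^ (j : ℕ)) = w (p.coeff i • x ^ (i : ℕ)) := by
    by_contra! h
    apply hi0
    rw [← w.map_sum_eq_of_lt (f := fun k : Fin (p.natDegree + 1) => p.coeff k • x ^ (k : ℕ))
      (Finset.mem_univ i) fun k hk => ?_, hp, map_zero]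
    have hki : k ≠ i := by simpa using hk
    exact lt_of_le_of_ne (hi k (Finset.mem_univ _)) (h k hki)
  have key : ∀ k l : ℕ, k < l → w (p.coeff k • x ^ k) = w (p.coeff l • x ^ l) →
      w (p.coeff l • x ^ l) ≠ 0 → ∃ N : ℕ, 0 < N ∧ ∃ c : K, w x ^ N = w (algebraMap K L c) := by
    intro k l hkl h h0
    refine ⟨l - k, by omega, p.coeff k / p.coeff l, ?_⟩
    rw [Algebra.smul_def, Algebra.smul_def, map_mul, map_mul, map_pow, map_pow] at h
    rw [Algebra.smul_def, map_mul] at h0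
    have hl := left_ne_zero_of_mul h0
    rw [map_div₀, map_div₀, eq_div_iff hl]
    apply mul_right_cancel₀ (pow_ne_zero k hwx)
    rw [h, mul_right_comm, ← pow_add, Nat.sub_add_cancel hkl.le, mul_comm]
  rcases lt_or_gt_of_ne hji with h | h
  · exact key j i h hj hi0
  · exact key i j h hj.symm (hj ▸ hi0)

/-- Valuations of an algebraic extension that extend an archimedean valuation are archimedean. -/
theorem Valuation.HasExtension.exists_le_pow [MulArchimedean Γ₀] [Algebra.IsAlgebraic K L]
    (v : Valuation K Γ₀) (w : Valuation L Γ) [v.HasExtension w] {x : L} (hx : 1 < w x) (y : L) :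
    ∃ N : ℕ, w y ≤ w x ^ N := by
  rcases le_or_gt (w y) 1 with hy | hy
  · exact ⟨0, by simpa using hy⟩
  have h0 : ∀ z : L, 1 < w z → z ≠ 0 := by
    rintro z hz rfl
    simp at hz
  obtain ⟨N, hN, c, hc⟩ := w.exists_pow_eq_algebraMap (K := K) (h0 x hx)
  obtain ⟨M, hM, d, hd⟩ := w.exists_pow_eq_algebraMap (K := K) (h0 y hy)
  have hvc : 1 < v c := by
    rw [← v.map_one, ← Valuation.HasExtension.val_map_lt_iff v w, ← hc, map_one, map_one]
    exact one_lt_pow₀ hx hN.ne'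
  obtain ⟨k, hk⟩ := MulArchimedean.arch (v d) hvc
  refine ⟨N * k, ?_⟩
  rw [← map_pow, ← Valuation.HasExtension.val_map_le_iff v w, ← hd, map_pow, map_pow, ← hc,
    ← pow_mul] at hk
  exact (le_self_pow₀ hy.le hM.ne').trans hk

/-- A nontrivial archimedean valuation is equivalent to a real absolute value. -/
theorem Valuation.exists_absoluteValue_le_iff (w : Valuation L Γ) [w.IsNontrivial]
    (harch : ∀ x y, 1 < w x → ∃ N : ℕ, w y ≤ w x ^ N) :
    ∃ b : AbsoluteValue L ℝ, ∀ x y, b x ≤ b y ↔ w x ≤ w y := by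
  have : MulArchimedean (MonoidWithZeroHom.ValueGroup₀ (.ofClass w)) := by
    refine ⟨fun s t ht => ?_⟩
    obtain ⟨y, rfl⟩ := MonoidWithZeroHom.ValueGroup₀.restrict₀_surjective _ s
    obtain ⟨x, rfl⟩ := MonoidWithZeroHom.ValueGroup₀.restrict₀_surjective _ t
    rw [← Valuation.restrict_def] at ht
    simp only [← Valuation.restrict_def]
    have hx : 1 < w x := by
      rw [← w.restrict.map_one] at ht
      simpa using w.restrict_lt_iff.1 ht
    obtain ⟨N, hN⟩ := harch x y hx
    refine ⟨N, ?_⟩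
    rw [← map_pow, w.restrict_le_iff, map_pow]
    exact hN
  obtain ⟨hr⟩ := Valuation.nonempty_rankOne_iff_mulArchimedean.2 this
  have hmono : StrictMono fun g => ((Valuation.RankOne.hom w g : NNReal) : ℝ) :=
    fun _ _ h => NNReal.coe_lt_coe.2 (Valuation.RankOne.strictMono w h)
  refine ⟨⟨⟨fun x => (Valuation.RankOne.hom w (w.restrict x) : ℝ), fun x y => by simp⟩,
    fun x => NNReal.coe_nonneg _, fun x => ?_, fun x y => ?_⟩, fun x y => ?_⟩
  · simp
  · have := hmono.monotone (w.restrict.map_add x y)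
    rw [hmono.monotone.map_max] at this
    refine this.trans (max_le ?_ ?_) <;> simp
  · exact hmono.le_iff_le.trans w.restrict_le_iff

/-- Weak approximation: pairwise inequivalent archimedean valuations are separated by units. -/
theorem Valuation.exists_eq_one_lt_one_pi {ι : Type*} [Finite ι] {Γ : ι → Type*}
    [∀ i, LinearOrderedCommGroupWithZero (Γ i)] (w : ∀ i, Valuation L (Γ i))
    (hnt : ∀ i, (w i).IsNontrivial)
    (harch : ∀ i x y, 1 < w i x → ∃ N : ℕ, w i y ≤ w i x ^ N)
    (hne : ∀ i j, i ≠ j → ¬ (w i).IsEquiv (w j)) (i : ι) :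
    ∃ a : L, w i a = 1 ∧ ∀ j ≠ i, w j a < 1 := by
  choose b hb using fun i => (w i).exists_absoluteValue_le_iff (harch i)
  have hlt : ∀ i x y, b i x < b i y ↔ w i x < w i y := fun i x y => by
    simpa only [not_le] using (hb i y x).not
  have hb_nt : ∀ i, (b i).IsNontrivial := fun i => by
    obtain ⟨x, hx0, hx1⟩ := (hnt i).exists_val_nontrivial
    refine ⟨x, by rintro rfl; simp at hx0, fun h => hx1 ?_⟩
    rw [← (b i).map_one] at h
    apply le_antisymm
    · simpa using (hb i x 1).1 h.le
    · simpa using (hb i 1 x).1 h.ge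
  have hb_ne : Pairwise fun i j => ¬ (b i).IsEquiv (b j) := fun i j hij h =>
    hne i j hij fun x y => by
      rw [← hb, ← hb]
      exact h x y
  obtain ⟨a, ha, haj⟩ := AbsoluteValue.exists_one_lt_lt_one_pi_of_not_isEquiv hb_nt hb_ne i
  rw [← (b i).map_one, hlt, map_one] at ha
  have haj' : ∀ j ≠ i, w j a < 1 := fun j hj => by
    have := haj j hj
    rwa [← (b j).map_one, hlt, map_one] at this
  -- `1 + a` has the value of `a` where `a` is large and the value `1` where `a` is small.
  refine ⟨a / (1 + a), ?_, fun j hj => ?_⟩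
  · rw [map_div₀, (w i).map_add_eq_of_lt_right (by simpa using ha),
      div_self (zero_lt_one.trans ha).ne']
  · rw [map_div₀, (w j).map_one_add_of_lt (haj' j hj), div_one]
    exact haj' j hj

end General

/-! ### One-slope Newton polygons. -/

section Newton

variable {L Γ : Type*} [Field L] [LinearOrderedCommGroupWithZero Γ]

/-- The value of a root of a polynomial whose Newton polygon has a single slope. -/
theorem Valuation.pow_eq_of_one_slope (w : Valuation L Γ) {n : ℕ} (hn : n ≠ 0) (y : L) (A : ℕ → L)
    (hy : y ^ n + ∑ i ∈ Finset.range n, A i * y ^ i = 0)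
    (hA : ∀ i < n, w (A i) ^ n ≤ w (A 0) ^ (n - i)) : w y ^ n = w (A 0) := by
  have hbound : ∀ i < n, w (A i * y ^ i) ^ n ≤ w (A 0) ^ (n - i) * (w y ^ n) ^ i := by
    intro i hi
    rw [map_mul, map_pow, mul_pow, ← pow_mul, ← pow_mul, mul_comm i n]
    exact mul_le_mul_of_nonneg_right (hA i hi) zero_le
  rcases lt_trichotomy (w y ^ n) (w (A 0)) with h | h | h
  -- If `y` is too small, `A 0` strictly dominates all other terms; in the opposite case below, `y ^
  -- n` does. Neither is compatible with a zero sum.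
  · exfalso
    have hG : 0 < w (A 0) := lt_of_le_of_lt zero_le h
    obtain ⟨k, rfl⟩ := Nat.exists_eq_succ_of_ne_zero hn
    have hsum : w (y ^ (k + 1) + ∑ i ∈ Finset.range k, A (i + 1) * y ^ (i + 1)) < w (A 0) := by
      refine w.map_add_lt (by rwa [map_pow]) (w.map_sum_lt hG.ne' fun i hi => ?_)
      rw [Finset.mem_range] at hi
      refine lt_of_pow_lt_pow_left₀ (k + 1) zero_le ((hbound (i + 1) (by omega)).trans_lt ?_)
      calc w (A 0) ^ (k + 1 - (i + 1)) * (w y ^ (k + 1)) ^ (i + 1)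
          < w (A 0) ^ (k + 1 - (i + 1)) * w (A 0) ^ (i + 1) :=
            mul_lt_mul_of_pos_left (pow_lt_pow_left₀ h zero_le (by omega)) (pow_pos hG _)
        _ = w (A 0) ^ (k + 1) := by rw [← pow_add]; congr 1; omega
    rw [Nat.succ_eq_add_one, Finset.sum_range_succ', ← add_assoc] at hy
    rw [eq_neg_of_add_eq_zero_left hy] at hsum
    simp at hsum
  · exact h
  · exfalso
    have hY : 0 < w y ^ n := lt_of_le_of_lt zero_le h
    have hsum : w (∑ i ∈ Finset.range n, A i * y ^ i) < w y ^ n := by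
      refine w.map_sum_lt hY.ne' fun i hi => ?_
      rw [Finset.mem_range] at hi
      refine lt_of_pow_lt_pow_left₀ n zero_le ((hbound i hi).trans_lt ?_)
      calc w (A 0) ^ (n - i) * (w y ^ n) ^ i
          < (w y ^ n) ^ (n - i) * (w y ^ n) ^ i :=
            mul_lt_mul_of_pos_right (pow_lt_pow_left₀ h zero_le (by omega)) (pow_pos hY _)
        _ = (w y ^ n) ^ n := by rw [← pow_add]; congr 1; omega
    rw [eq_neg_of_add_eq_zero_right hy, Valuation.map_neg, map_pow] at hsum
    exact hsum.false

end Newton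

/-! ### Gauss values and reduction. -/

section Gauss

variable {K : Type*} [Field K] (v : Valuation K ℤᵐ⁰)

theorem coeff_le_gaussValue (p : v.valuationSubring[X]) (k : ℕ) :
    v (p.coeff k : K) ≤ gaussValue v p := by
  by_cases hk : k ∈ p.support
  · exact Finset.le_sup (f := fun j => v (p.coeff j : K)) hk
  · rw [notMem_support_iff.1 hk]
    simp

theorem exists_coeff_eq_gaussValue {p : v.valuationSubring[X]} (hp : p ≠ 0) :
    ∃ k, p.coeff k ≠ 0 ∧ v (p.coeff k : K) = gaussValue v p := by
  obtain ⟨k, hk, h⟩ := Finset.exists_mem_eq_sup p.support (support_nonempty.2 hp)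
    fun j => v (p.coeff j : K)
  exact ⟨k, mem_support_iff.1 hk, h.symm⟩

theorem gaussValue_ne_zero {p : v.valuationSubring[X]} (hp : p ≠ 0) : gaussValue v p ≠ 0 := by
  obtain ⟨k, hk, h⟩ := exists_coeff_eq_gaussValue v hp
  rw [← h]
  simpa using hk

theorem valuationSubring_residue_eq_zero_iff (x : v.valuationSubring) :
    IsLocalRing.residue v.valuationSubring x = 0 ↔ v (x : K) < 1 := by
  rw [IsLocalRing.residue_eq_zero_iff, ValuationSubring.valuation_lt_one_iff]
  exact (v.isEquiv_valuation_valuationSubring.lt_one_iff_lt_one).symm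

end Gauss

/-! ### Values at `α` under a single extension. -/

section Local

variable {K L Γ : Type*} [Field K] [Field L] [Algebra K L] [LinearOrderedCommGroupWithZero Γ]
  (v : Valuation K ℤᵐ⁰) (w : Valuation L Γ) [v.HasExtension w] {α : L}

theorem valuation_aeval_le (hα : w α ≤ 1) (p : K[X]) (c : K) (hp : ∀ k, v (p.coeff k) ≤ v c) :
    w (aeval α p) ≤ w (algebraMap K L c) := by
  rw [aeval_eq_sum_range]
  refine w.map_sum_le fun k _ => ?_
  rw [Algebra.smul_def, map_mul, map_pow]
  calc _ ≤ w (algebraMap K L c) * 1 := by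
        gcongr
        · exact (Valuation.HasExtension.val_map_le_iff v w _ _).2 (hp k)
        · exact pow_le_one₀ zero_le hα
    _ = _ := mul_one _

theorem valuation_aeval_lt_one (hα : w α ≤ 1) (p : K[X]) (hp : ∀ k, v (p.coeff k) < 1) :
    w (aeval α p) < 1 := by
  rw [aeval_eq_sum_range]
  refine w.map_sum_lt one_ne_zero fun k _ => ?_
  rw [Algebra.smul_def, map_mul, map_pow]
  exact mul_lt_one_of_nonneg_of_lt_one_left zero_le
    ((Valuation.HasExtension.val_map_lt_one_iff v w _).2 (hp k)) (pow_le_one₀ zero_le hα)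

theorem valuation_aeval_map_le_one (hα : w α ≤ 1) (q : v.valuationSubring[X]) :
    w (aeval α (q.map (algebraMap v.valuationSubring K))) ≤ 1 := by
  have := valuation_aeval_le v w hα (q.map (algebraMap v.valuationSubring K)) 1 fun k => by
    rw [coeff_map, map_one]
    exact (q.coeff k).2
  simpa using this

theorem valuation_aeval_map_lt_one (hα : w α ≤ 1) (q : v.valuationSubring[X])
    (hq : q.map (IsLocalRing.residue v.valuationSubring) = 0) :
    w (aeval α (q.map (algebraMap v.valuationSubring K))) < 1 := by
  refine valuation_aeval_lt_one v w hα _ fun k => ?_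
  rw [coeff_map]
  refine (valuationSubring_residue_eq_zero_iff v _).1 ?_
  rw [← coeff_map, hq, coeff_zero]

theorem valuation_root_le_one {f : v.valuationSubring[X]} (hf : f.Monic)
    (hα : aeval α (f.map (algebraMap v.valuationSubring K)) = 0) : w α ≤ 1 := by
  by_contra! h
  rw [aeval_eq_sum_range, natDegree_map_eq_of_injective (Subtype.val_injective),
    Finset.sum_range_succ, coeff_map, hf.coeff_natDegree, map_one, one_smul] at hα
  have hlt : w (∑ k ∈ Finset.range f.natDegree,
      (f.map (algebraMap v.valuationSubring K)).coeff k • α ^ k) < w α ^ f.natDegree := by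
    refine w.map_sum_lt (pow_ne_zero _ (zero_lt_one.trans h).ne') fun k hk => ?_
    rw [Algebra.smul_def, map_mul, map_pow, coeff_map]
    refine mul_lt_of_le_one_of_lt ?_ (pow_lt_pow_right₀ h (Finset.mem_range.1 hk))
    exact (Valuation.HasExtension.val_map_le_one_iff v w _).2 (f.coeff k).2
  rw [eq_neg_of_add_eq_zero_left hα, Valuation.map_neg, map_pow] at hlt
  exact hlt.false

variable {φ : v.valuationSubring[X]}

/-- The coefficients of `f - φ ^ l` reduce to zero, so its value at `α`, which is `-φ(α)^l`, is
small. -/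
theorem valuation_aeval_key_lt_one {f : v.valuationSubring[X]} {l : ℕ} (hf : f.Monic)
    (hf_pow : f.map (IsLocalRing.residue v.valuationSubring) =
      φ.map (IsLocalRing.residue v.valuationSubring) ^ l)
    (hα : aeval α (f.map (algebraMap v.valuationSubring K)) = 0) :
    w (aeval α (φ.map (algebraMap v.valuationSubring K))) < 1 := by
  have hα1 := valuation_root_le_one v w hf hα
  have h := valuation_aeval_map_lt_one v w hα1 (f - φ ^ l) (by simp [hf_pow])
  rw [Polynomial.map_sub, map_sub, hα, zero_sub, Valuation.map_neg, Polynomial.map_pow, map_pow,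
    map_pow] at h
  by_contra! h1
  exact h.not_ge (one_le_pow₀ h1)

/-- The reductions of `φ` and `q` are coprime. Lifting a Bézout relation shows that `φ(α)` and
`q(α)` cannot both be small, as `1` would be small too. -/
theorem valuation_aeval_map_eq_one (hα : w α ≤ 1) (hφ : φ.Monic)
    (hφ_irr : Irreducible (φ.map (IsLocalRing.residue v.valuationSubring)))
    (hy : w (aeval α (φ.map (algebraMap v.valuationSubring K))) < 1)
    {q : v.valuationSubring[X]} (hdeg : q.degree < φ.degree)
    (hq : q.map (IsLocalRing.residue v.valuationSubring) ≠ 0) :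
    w (aeval α (q.map (algebraMap v.valuationSubring K))) = 1 := by
  refine le_antisymm (valuation_aeval_map_le_one v w hα q) (le_of_not_gt fun hlt => ?_)
  have hcop : IsCoprime (φ.map (IsLocalRing.residue v.valuationSubring))
      (q.map (IsLocalRing.residue v.valuationSubring)) := by
    refine hφ_irr.coprime_iff_not_dvd.2 fun hdvd => ?_
    have h1 := degree_le_of_dvd hdvd hq
    rw [hφ.degree_map] at h1
    exact (h1.trans degree_map_le).not_gt hdeg
  obtain ⟨s, t, hst⟩ := hcop
  obtain ⟨s, rfl⟩ := map_surjective _ IsLocalRing.residue_surjective s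
  obtain ⟨t, rfl⟩ := map_surjective _ IsLocalRing.residue_surjective t
  have h := valuation_aeval_map_lt_one v w hα (1 - (s * φ + t * q)) (by simp [hst])
  have h2 : w (aeval α ((s * φ + t * q).map (algebraMap v.valuationSubring K))) < 1 := by
    simp only [Polynomial.map_add, Polynomial.map_mul, map_add, map_mul]
    refine w.map_add_lt ?_ ?_ <;> rw [map_mul]
    · exact mul_lt_one_of_nonneg_of_lt_one_right (valuation_aeval_map_le_one v w hα s) zero_le hy
    · exact mul_lt_one_of_nonneg_of_lt_one_right (valuation_aeval_map_le_one v w hα t) zero_le hlt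
  have h3 := w.map_add_lt h h2
  rw [← map_add, ← Polynomial.map_add, sub_add_cancel] at h3
  simp at h3

/-- Polynomials of degree less than that of `φ` take their Gauss value at `α`. -/
theorem valuation_aeval_eq (hα : w α ≤ 1) (hφ : φ.Monic)
    (hφ_irr : Irreducible (φ.map (IsLocalRing.residue v.valuationSubring)))
    (hy : w (aeval α (φ.map (algebraMap v.valuationSubring K))) < 1)
    {p : K[X]} (hdeg : p.degree < φ.degree) {c : K} (hp : ∀ k, v (p.coeff k) ≤ v c)
    {k : ℕ} (hk : v (p.coeff k) = v c) :
    w (aeval α p) = w (algebraMap K L c) := by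
  rcases eq_or_ne c 0 with rfl | hc
  · simpa using valuation_aeval_le v w hα p 0 hp
  have hvc : v c ≠ 0 := by simpa using hc
  -- Dividing by `c` makes `p` integral with coefficient `k` a unit, hence with nonzero reduction.
  have hlift : C c⁻¹ * p ∈ lifts (algebraMap v.valuationSubring K) := by
    rw [lifts_iff_coeff_lifts]
    intro j
    refine ⟨⟨(C c⁻¹ * p).coeff j, ?_⟩, rfl⟩
    rw [Valuation.mem_valuationSubring_iff, coeff_C_mul, map_mul, map_inv₀,
      inv_mul_le_one₀ (zero_lt_iff.2 hvc)]
    exact hp j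
  obtain ⟨q, hq⟩ := hlift
  replace hq : q.map (algebraMap v.valuationSubring K) = C c⁻¹ * p := hq
  have hp_eq : p = C c * q.map (algebraMap v.valuationSubring K) := by
    rw [hq, ← mul_assoc, ← C_mul, mul_inv_cancel₀ hc, C_1, one_mul]
  have hqdeg : q.degree < φ.degree := by
    rwa [← degree_map_eq_of_injective (f := algebraMap v.valuationSubring K)
      Subtype.val_injective q, hq, degree_C_mul (inv_ne_zero hc)]
  have hqk : q.map (IsLocalRing.residue v.valuationSubring) ≠ 0 := by
    intro h0
    have h1 := congrArg (coeff · k) h0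
    simp only [coeff_map, coeff_zero] at h1
    rw [valuationSubring_residue_eq_zero_iff] at h1
    have h2 : (q.coeff k : K) = (q.map (algebraMap v.valuationSubring K)).coeff k := by
      rw [coeff_map]; rfl
    rw [h2, hq, coeff_C_mul, map_mul, map_inv₀, hk, inv_mul_cancel₀ hvc] at h1
    exact h1.false
  rw [hp_eq, map_mul, map_mul, valuation_aeval_map_eq_one v w hα hφ hφ_irr hy hqdeg hqk, mul_one,
    aeval_C]

end Local

/-! ### Linear independence and the dimension count. -/

section Main

/-- A relation among terms that are separated in value, first by the exponent `j` and then by the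
valuation `w i`, is trivial. -/
theorem eq_zero_of_sum_separated {K L ι κ Γ₀ : Type*} [Field K] [Field L] [Algebra K L] [Fintype ι]
    [Fintype κ] [LinearOrderedCommGroupWithZero Γ₀] (v : Valuation K Γ₀) {Γ : ι → Type*}
    [∀ i, LinearOrderedCommGroupWithZero (Γ i)] (w : ∀ i, Valuation L (Γ i))
    (hw : ∀ i, v.HasExtension (w i)) (b : ι → L) (hb : ∀ i, w i (b i) = 1)
    (hb' : ∀ i j, j ≠ i → w j (b i) < 1) {n : ℕ} (hn : n ≠ 0) (t : ι → κ → L) (u : ι → κ → K)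
    (htu : ∀ k i j, w k (t i j) ^ n = w k (algebraMap K L (u i j)))
    (hu : ∀ i j j', v (u i j) = v (u i j') → u i j ≠ 0 → j = j')
    (hsum : ∑ i, b i * ∑ j, t i j = 0) (i : ι) (j : κ) : u i j = 0 := by
  classical
  -- The maximum is taken in `K`: by `htu`, `v (u i j)` orders the terms `t i j` in the same way for
  -- every `w k`. The contradiction is then read off at `w i₀`.
  obtain ⟨⟨i₀, j₀⟩, -, hmax⟩ := Finset.exists_max_image Finset.univ
    (fun x : ι × κ => v (u x.1 x.2)) ⟨(i, j), Finset.mem_univ _⟩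
  simp only [Finset.mem_univ, true_implies, Prod.forall] at hmax
  by_contra hne
  have h0 : v (u i₀ j₀) ≠ 0 := fun h => by
    have := hmax i j
    rw [h] at this
    simp [hne] at this
  have hle : ∀ i j, w i₀ (t i j) ≤ w i₀ (t i₀ j₀) := fun i j => by
    have := hw i₀
    rw [← pow_le_pow_iff_left₀ zero_le zero_le hn, htu, htu,
      Valuation.HasExtension.val_map_le_iff v (w i₀)]
    exact hmax i j
  have hlt : ∀ j ≠ j₀, w i₀ (t i₀ j) < w i₀ (t i₀ j₀) := fun j hj => by
    have := hw i₀
    rw [← pow_lt_pow_iff_left₀ zero_le zero_le hn, htu, htu,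
      Valuation.HasExtension.val_map_lt_iff v (w i₀)]
    exact lt_of_le_of_ne (hmax i₀ j) fun h => hj (hu i₀ j₀ j h.symm (by simpa using h0)).symm
  have ht0 : w i₀ (t i₀ j₀) ≠ 0 := fun h => h0 <| by
    have h1 := htu i₀ i₀ j₀
    rw [h, zero_pow hn] at h1
    simpa using h1.symm
  have hrow : w i₀ (∑ j, t i₀ j) = w i₀ (t i₀ j₀) :=
    (w i₀).map_sum_eq_of_lt (Finset.mem_univ j₀) fun j hj => hlt j (by simpa using hj)
  have htot : w i₀ (∑ i, b i * ∑ j, t i j) = w i₀ (b i₀ * ∑ j, t i₀ j) := by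
    -- No other row exceeds the dominant term at `w i₀`, and its factor `b i` makes it strictly
    -- smaller.
    refine (w i₀).map_sum_eq_of_lt (f := fun i => b i * ∑ j, t i j) (Finset.mem_univ i₀)
      fun i hi => ?_
    have hi' : i ≠ i₀ := by simpa using hi
    rw [map_mul, map_mul, hb, one_mul, hrow]
    calc w i₀ (b i) * w i₀ (∑ j, t i j) ≤ w i₀ (b i) * w i₀ (t i₀ j₀) :=
          mul_le_mul_of_nonneg_left ((w i₀).map_sum_le fun j _ => hle i j) zero_le
      _ < w i₀ (t i₀ j₀) :=
          mul_lt_of_lt_one_left (zero_lt_iff.2 ht0) (hb' i i₀ hi'.symm)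
  rw [hsum, map_zero, map_mul, hb, one_mul, hrow] at htot
  exact ht0 htot.symm

/-- The values `v c ^ n * g ^ j` with `j < n / gcd (log g) n` determine `j`. -/
theorem WithZero.eq_of_pow_mul_pow_eq {x y g : ℤᵐ⁰} (hx : x ≠ 0) (hy : y ≠ 0) (hg : g ≠ 0) {n : ℕ}
    (hn : n ≠ 0) {j j' : ℕ} (hj : j < n / Int.gcd (WithZero.log g) n)
    (hj' : j' < n / Int.gcd (WithZero.log g) n) (h : x ^ n * g ^ j = y ^ n * g ^ j') : j = j' := by
  have h1 := congrArg WithZero.log h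
  rw [WithZero.log_mul (pow_ne_zero _ hx) (pow_ne_zero _ hg),
    WithZero.log_mul (pow_ne_zero _ hy) (pow_ne_zero _ hg)] at h1
  simp only [WithZero.log_pow, nsmul_eq_mul] at h1
  set d := Int.gcd (WithZero.log g) n with hd
  have hdpos : 0 < d := Int.gcd_pos_of_ne_zero_right _ (by exact_mod_cast hn)
  obtain ⟨r, hr⟩ : (d : ℤ) ∣ WithZero.log g := Int.gcd_dvd_left _ _
  obtain ⟨e, he⟩ : d ∣ n := by exact_mod_cast (Int.gcd_dvd_right (WithZero.log g) (n : ℤ))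
  have hcop : IsCoprime (e : ℤ) r := by
    rw [Int.isCoprime_iff_gcd_eq_one, Int.gcd_comm]
    have h2 : d = d * Int.gcd r e := by
      conv_lhs => rw [hd, hr, he]
      rw [Nat.cast_mul, Int.gcd_mul_left, Int.natAbs_natCast]
    exact Nat.eq_of_mul_eq_mul_left hdpos (by omega)
  -- Taking logarithms and dividing by `d` gives `e ∣ r * (j - j')` with `e` and `r` coprime; since
  -- `j, j' < e`, they coincide.
  have hdiv : (e : ℤ) ∣ (j : ℤ) - j' := by
    refine hcop.dvd_of_dvd_mul_left ⟨WithZero.log y - WithZero.log x, ?_⟩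
    have hd0 : (d : ℤ) ≠ 0 := by exact_mod_cast hdpos.ne'
    apply mul_left_cancel₀ hd0
    rw [hr, he] at h1
    push_cast at h1
    linear_combination h1
  rw [he, Nat.mul_div_cancel_left _ hdpos] at hj hj'
  obtain ⟨z, hz⟩ := hdiv
  have : z = 0 := by
    by_contra hz0
    have := Int.le_of_dvd (a := e) (b := |(j : ℤ) - j'|) (by
      rw [hz, abs_pos]; exact mul_ne_zero (by omega) hz0) ((dvd_abs _ _).2 ⟨z, hz⟩)
    rw [le_abs] at this
    omega
  rw [this] at hz
  omega

theorem IsMonicExpansion.natDegree_le {R : Type*} [CommRing R] {f φ : R[X]} {n : ℕ}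
    {a : ℕ → R[X]} (h : IsMonicExpansion f φ n a) : f.natDegree ≤ n * φ.natDegree := by
  rw [h.1]
  refine (natDegree_add_le _ _).trans (max_le natDegree_pow_le
    (natDegree_sum_le_of_forall_le _ _ fun i hi => ?_))
  have hi' := Finset.mem_range.1 hi
  calc (a i * φ ^ i).natDegree ≤ φ.natDegree + i * φ.natDegree :=
        natDegree_mul_le.trans (add_le_add (natDegree_le_natDegree (h.2 i hi').le) natDegree_pow_le)
    _ = (i + 1) * φ.natDegree := by ring
    _ ≤ n * φ.natDegree := Nat.mul_le_mul_right _ hi'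

/-- This is the slope hypothesis with denominators cleared; the multiplicative convention reverses
the inequality. -/
theorem gaussValue_pow_le {K : Type*} [Field K] (v : Valuation K ℤᵐ⁰) {n i : ℕ} (hi : i < n)
    {p q : v.valuationSubring[X]} (hp : p ≠ 0) (h : q ≠ 0 →
      (gaussOrd v p : ℚ) - i * ((gaussOrd v p : ℚ) / n) ≤ (gaussOrd v q : ℚ)) :
    gaussValue v q ^ n ≤ gaussValue v p ^ (n - i) := by
  have hn : (0 : ℚ) < n := by exact_mod_cast (by omega : 0 < n)
  rcases eq_or_ne q 0 with rfl | hq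
  · have : gaussValue v (0 : v.valuationSubring[X]) = 0 := by simp [gaussValue]
    rw [this, zero_pow (by omega)]
    exact zero_le
  rw [← WithZero.log_le_log (pow_ne_zero _ (gaussValue_ne_zero v hq))
    (pow_ne_zero _ (gaussValue_ne_zero v hp)), WithZero.log_pow, WithZero.log_pow, nsmul_eq_mul,
    nsmul_eq_mul, Nat.cast_sub hi.le]
  have h1 := mul_le_mul_of_nonneg_left (h hq) hn.le
  have h2 : (n : ℚ) * ((gaussOrd v p : ℚ) - i * ((gaussOrd v p : ℚ) / n)) =
      (n - i) * gaussOrd v p := by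
    field_simp
  rw [h2] at h1
  have h3 : ((n : ℤ) - i) * gaussOrd v p ≤ n * gaussOrd v q := by exact_mod_cast h1
  rw [gaussOrd, gaussOrd] at h3
  linarith

/-- The value of `φ` at a root of `f`. -/
theorem valuation_aeval_key_pow {K L Γ : Type*} [Field K] [Field L] [Algebra K L]
    [LinearOrderedCommGroupWithZero Γ] (v : Valuation K ℤᵐ⁰) (w : Valuation L Γ)
    [v.HasExtension w] {α : L} (hα : w α ≤ 1) {f φ : v.valuationSubring[X]} (hφ : φ.Monic)
    (hφ_irr : Irreducible (φ.map (IsLocalRing.residue v.valuationSubring)))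
    (hy : w (aeval α (φ.map (algebraMap v.valuationSubring K))) < 1)
    {n : ℕ} (hn : n ≠ 0) {a : ℕ → v.valuationSubring[X]} (hexp : IsMonicExpansion f φ n a)
    (ha : ∀ i < n, gaussValue v (a i) ^ n ≤ gaussValue v (a 0) ^ (n - i))
    (hroot : aeval α (f.map (algebraMap v.valuationSubring K)) = 0) {c : K}
    (hc : v c = gaussValue v (a 0)) :
    w (aeval α (φ.map (algebraMap v.valuationSubring K))) ^ n = w (algebraMap K L c) := by
  have hval : ∀ i < n, ∀ d : K, v d = gaussValue v (a i) →
      w (aeval α ((a i).map (algebraMap v.valuationSubring K))) = w (algebraMap K L d) := by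
    intro i hi d hd
    rcases eq_or_ne (a i) 0 with h0 | h0
    · rw [h0] at hd ⊢
      have : d = 0 := by simpa [gaussValue] using hd
      simp [this]
    obtain ⟨k, -, hk⟩ := exists_coeff_eq_gaussValue v h0
    refine valuation_aeval_eq v w hα hφ hφ_irr hy (degree_map_le.trans_lt (hexp.2 i hi)) (c := d)
      (fun k => ?_) (k := k) ?_
    · rw [coeff_map, hd]
      exact coeff_le_gaussValue v _ k
    · rw [coeff_map, hd]
      exact hk
  have hex : ∀ p : v.valuationSubring[X], ∃ d : K, v d = gaussValue v p := fun p => by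
    rcases eq_or_ne p 0 with rfl | h0
    · exact ⟨0, by simp [gaussValue]⟩
    · obtain ⟨k, -, hk⟩ := exists_coeff_eq_gaussValue v h0
      exact ⟨_, hk⟩
  rw [← hval 0 (by omega) c hc]
  refine w.pow_eq_of_one_slope hn _
    (fun i => aeval α ((a i).map (algebraMap v.valuationSubring K))) ?_ fun i hi => ?_
  · rw [hexp.1] at hroot
    simpa [Polynomial.map_sum] using hroot
  · obtain ⟨d, hd⟩ := hex (a i)
    rw [hval i hi d hd, hval 0 (by omega) c hc, ← map_pow, ← map_pow, ← map_pow, ← map_pow,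
      Valuation.HasExtension.val_map_le_iff v w, map_pow, map_pow, hd, hc]
    exact ha i hi

theorem exists_coeff_max {K Γ₀ : Type*} [Field K] [LinearOrderedCommGroupWithZero Γ₀]
    (v : Valuation K Γ₀) (p : K[X]) :
    ∃ k, ∀ l, v (p.coeff l) ≤ v (p.coeff k) := by
  obtain ⟨k, -, hk⟩ := Finset.exists_max_image (Finset.range (p.natDegree + 1))
    (fun k => v (p.coeff k)) ⟨0, by simp⟩
  refine ⟨k, fun l => ?_⟩
  by_cases hl : l ≤ p.natDegree
  · exact hk l (by simpa [Nat.lt_succ_iff] using hl)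
  · rw [coeff_eq_zero_of_natDegree_lt (by omega)]
    simp

/-- The combinations `∑ i, b i * ∑ j, p i j (α) * y ^ j` as a linear map in the polynomials
`p i j` of degree less than `m`. -/
noncomputable def separatedSum (K : Type*) {L ι : Type*} [Field K] [Field L] [Algebra K L]
    [Fintype ι] (b : ι → L) (α y : L) (e m : ℕ) : (ι → Fin e → degreeLT K m) →ₗ[K] L where
  toFun p := ∑ i, b i * ∑ j, aeval α (p i j : K[X]) * y ^ (j : ℕ)
  map_add' p q := by simp [add_mul, mul_add, Finset.sum_add_distrib]
  map_smul' c p := by simp [← Finset.smul_sum]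

theorem finrank_pi_pi_degreeLT (K ι : Type*) [Field K] [Fintype ι] (e m : ℕ) :
    Module.finrank K (ι → Fin e → degreeLT K m) = Fintype.card ι * (e * m) := by
  have : Module.finrank K (degreeLT K m) = m := by simp [(degreeLTEquiv K m).finrank_eq]
  have : Module.Finite K (degreeLT K m) := Module.Finite.equiv (degreeLTEquiv K m).symm
  simp [Module.finrank_pi_fintype, *]

end Main

theorem mainTheorem3 {K : Type*} [Field K]
    -- a discrete valuation of rank one, normalized so that its value group is `ℤ`
    (v : Valuation K ℤᵐ⁰) (hv : Function.Surjective v)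
    (f φ : v.valuationSubring[X]) (hf : f.Monic) (hφ : φ.Monic)
    (hφ_irr : Irreducible (φ.map (IsLocalRing.residue v.valuationSubring)))
    (hf_pow : ∃ l : ℕ, f.map (IsLocalRing.residue v.valuationSubring) =
      φ.map (IsLocalRing.residue v.valuationSubring) ^ l)
    (n : ℕ) (a : ℕ → v.valuationSubring[X]) (hexp : IsMonicExpansion f φ n a) (ha₀ : a 0 ≠ 0)
    -- `ν(a_i) ≥ ν(a_0) - i λ` with `λ = ν(a_0) / n`; there is nothing to require if `ν(a_i) = ∞`
    (hval : ∀ i < n, a i ≠ 0 →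
      (gaussOrd v (a 0) : ℚ) - i * ((gaussOrd v (a 0) : ℚ) / n) ≤ (gaussOrd v (a i) : ℚ))
    (hf_irr : Irreducible (f.map (algebraMap v.valuationSubring K)))
    {L : Type*} [Field L] [Algebra K L] (α : L)
    (hα : aeval α (f.map (algebraMap v.valuationSubring K)) = 0)
    (hL : IntermediateField.adjoin K {α} = ⊤)
    -- any family of pairwise inequivalent valuations of `L` extending `v`, with any value groups
    {ι : Type*} (Γ : ι → Type*) [∀ i, LinearOrderedCommGroupWithZero (Γ i)]
    (w : ∀ i, Valuation L (Γ i)) (hw : ∀ i, v.HasExtension (w i))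
    (hw_ne : ∀ i j, i ≠ j → ¬ (w i).IsEquiv (w j)) :
    Finite ι ∧ Nat.card ι ≤ Int.gcd (gaussOrd v (a 0)) n := by

  classical
  have hroot := hα
  have hn : n ≠ 0 := by
    rintro rfl
    have h1 : f = 1 := by simpa using hexp.1
    exact hf_irr.not_isUnit (by simp [h1])
  have hfm : (f.map (algebraMap v.valuationSubring K)).Monic := hf.map _
  have hint : IsIntegral K α := ⟨_, hfm, by rwa [← aeval_def]⟩
  have hmin : minpoly K α = f.map (algebraMap v.valuationSubring K) :=
    (minpoly.eq_of_irreducible_of_monic hf_irr hα hfm).symm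
  have hrank : Module.finrank K L ≤ n * φ.natDegree := by
    rw [← IntermediateField.finrank_top', ← hL, IntermediateField.adjoin.finrank hint, hmin,
      hf.natDegree_map]
    exact hexp.natDegree_le
  have hfin : FiniteDimensional K L := by
    have := IntermediateField.adjoin.finiteDimensional hint
    rw [hL] at this
    exact Module.Finite.equiv IntermediateField.topEquiv.toLinearEquiv
  obtain ⟨π, hπ⟩ := hv (WithZero.exp 1)
  have hnt : ∀ i, (w i).IsNontrivial := fun i => by
    have := hw i
    refine ⟨algebraMap K L π, fun h => ?_, fun h => ?_⟩
    · rw [map_eq_zero, map_eq_zero] at h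
      rw [h, map_zero] at hπ
      exact WithZero.exp_ne_zero hπ.symm
    · rw [Valuation.HasExtension.val_map_eq_one_iff v (w i), hπ, WithZero.exp_eq_one] at h
      omega
  have harch : ∀ i x y, 1 < w i x → ∃ N : ℕ, w i y ≤ w i x ^ N := fun i x y hx => by
    have := hw i
    exact Valuation.HasExtension.exists_le_pow v (w i) hx y
  obtain ⟨l, hl⟩ := hf_pow
  obtain ⟨k₀, hk₀, hck₀⟩ := exists_coeff_eq_gaussValue v ha₀
  set c₀ : K := ((a 0).coeff k₀ : K) with hc₀
  set y := aeval α (φ.map (algebraMap v.valuationSubring K)) with hy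
  have hα1 : ∀ i, w i α ≤ 1 := fun i => by
    have := hw i
    exact valuation_root_le_one v (w i) hf hroot
  have hy1 : ∀ i, w i y < 1 := fun i => by
    have := hw i
    exact valuation_aeval_key_lt_one v (w i) hf hl hroot
  have hyn : ∀ i, w i y ^ n = w i (algebraMap K L c₀) := fun i => by
    have := hw i
    exact valuation_aeval_key_pow v (w i) (hα1 i) hφ hφ_irr (hy1 i) hn hexp
      (fun j hj => gaussValue_pow_le v hj ha₀ (hval j hj)) hroot hck₀
  have hg0 := gaussValue_ne_zero v ha₀
  set g := gaussValue v (a 0) with hg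
  have hgcd : Int.gcd (gaussOrd v (a 0)) n = Int.gcd (WithZero.log g) n := by
    rw [gaussOrd, Int.neg_gcd]
  rw [hgcd]
  set d := Int.gcd (WithZero.log g) n with hd
  have hdn : d ∣ n := by exact_mod_cast (Int.gcd_dvd_right (WithZero.log g) (n : ℤ))
  have hφpos : 0 < φ.natDegree := by
    rw [← hφ.natDegree_map (IsLocalRing.residue v.valuationSubring)]
    exact hφ_irr.natDegree_pos
  -- Bounding finite subfamilies gives the finiteness of `ι` as well as the count.
  have hinj : ∀ s : Finset ι, s.card ≤ d := by
    intro s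
    choose b hb hb' using Valuation.exists_eq_one_lt_one_pi (fun i : s => w i)
      (fun i => hnt i) (fun i => harch i) fun i j hij => hw_ne i j (Subtype.coe_ne_coe.2 hij)
    have hT : Function.Injective (separatedSum K b α y (n / d) φ.natDegree) := by
      rw [← LinearMap.ker_eq_bot, LinearMap.ker_eq_bot']
      intro p hp
      choose k hk using fun (i : s) (j : Fin (n / d)) => exists_coeff_max v (p i j : K[X])
      -- `u` represents in `K` the `n`-th power of the value of `p(α) y^j`: the extremal coefficient
      -- of `p` gives `w (p(α))`, and `c₀` replaces `y ^ n`.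
      have hu := eq_zero_of_sum_separated v (fun i : s => w i) (fun i => hw i) b hb hb' hn
        (fun i j => aeval α (p i j : K[X]) * y ^ (j : ℕ))
        (fun i j => (p i j : K[X]).coeff (k i j) ^ n * c₀ ^ (j : ℕ)) ?_ ?_ hp
      · have hc : c₀ ≠ 0 := by simpa [hc₀] using hk₀
        ext i j l
        have h0 : (p i j : K[X]).coeff (k i j) = 0 := by simpa [hc, hn] using hu i j
        simpa [h0] using hk i j l
      · intro i' i j
        have := hw i'
        rw [map_mul, mul_pow, map_mul, map_mul, map_pow, map_pow, map_pow, map_pow, map_pow,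
          ← hyn, valuation_aeval_eq v (w i') (hα1 i') hφ hφ_irr (hy1 i') ?_ (hk i j) rfl,
          ← pow_mul, ← pow_mul, mul_comm n]
        rw [degree_eq_natDegree hφ.ne_zero]
        exact mem_degreeLT.1 (p i j).2
      · intro i j j' h hne
        have h0 : v ((p i j : K[X]).coeff (k i j)) ^ n * g ^ (j : ℕ) ≠ 0 := by
          rw [← hck₀, ← map_pow, ← map_pow, ← map_mul]
          exact v.ne_zero_iff.2 hne
        have h1 := h
        rw [map_mul, map_mul, map_pow, map_pow, map_pow, map_pow, hck₀] at h1
        have h0' : v ((p i j' : K[X]).coeff (k i j')) ≠ 0 := by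
          intro hz
          rw [hz, zero_pow hn, zero_mul] at h1
          exact h0 h1
        exact Fin.ext (WithZero.eq_of_pow_mul_pow_eq ((pow_ne_zero_iff hn).1 (left_ne_zero_of_mul h0)) h0' hg0 hn
          j.2 j'.2 h1)
    have h1 := (LinearMap.finrank_le_finrank_of_injective hT).trans hrank
    rw [finrank_pi_pi_degreeLT, Fintype.card_coe, ← mul_assoc] at h1
    have h2 := Nat.le_of_mul_le_mul_right h1 hφpos
    have h3 : d * (n / d) = n := Nat.mul_div_cancel' hdn
    have h4 : 0 < n / d := Nat.div_pos (Nat.le_of_dvd (by omega) hdn)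
      (Nat.pos_of_dvd_of_pos hdn (by omega))
    refine Nat.le_of_mul_le_mul_right (h2.trans h3.ge) h4
  have hfinite : Finite ι := by
    by_contra hinf
    rw [not_finite_iff_infinite] at hinf
    obtain ⟨s, hs⟩ := Infinite.exists_subset_card_eq ι (d + 1)
    have := hinj s
    omega
  refine ⟨hfinite, ?_⟩
  have := Fintype.ofFinite ι
  rw [Nat.card_eq_fintype_card]
  exact hinj Finset.univ
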